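/- Let $N\ge 1$ and $\mathcal H_S=\bigotimes_{k=1}^N\mathbb C^2$. For a $2\times2$ matrix $a$ let $a^{(k)}$ be the operator on $\mathcal H_S$ acting as $a$ on the $k$-th factor and as the identity on the others. Let $\sigma_x,\sigma_y,\sigma_z$ be the Pauli matrices and $$\sigma_+=\begin{pmatrix}0&1\\0&0\end{pmatrix},\quad \sigma_-=\begin{pmatrix}0&0\\1&0\end{pmatrix},\quad n_+=\begin{pmatrix}1&0\\0&0\end{pmatrix},\quad n_-=\begin{pmatrix}0&0\\0&1\end{pmatrix},$$ $$H_S=\sum_{k=1}^N\sigma_z^{(k)}+\sum_{k=1}^{N-1}\bigl(\sigma_x^{(k)}\sigma_x^{(k+1)}+\sigma_y^{(k)}\sigma_y^{(k+1)}\bigr).$$ Let $\beta,\beta'\in\mathbb R$, and put $\beta_0=\frac{e^{-\beta}}{e^{-\beta}+e^{\beta}}$, $\beta_1=\frac{e^{\beta}}{e^{-\beta}+e^{\beta}}$, $\beta'_0=\frac{e^{-\beta'}}{e^{-\beta'}+e^{\beta'}}$, $\beta'_1=\frac{e^{\beta'}}{e^{-\beta'}+e^{\beta'}}$. With $[X,Y]=XY-YX$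 and $\{X,Y\}=XY+YX$, define on $\mathcal B(\mathcal H_S)$ the generator of the quantum master equation of the XY chain coupled at sites $1$ and $N$ to heat baths at inverse temperatures $\beta$ and $\beta'$ by $$\begin{aligned}\mathcal L^*(\rho)=-i[H_S,\rho]&+2\beta_0\bigl[2\sigma_+^{(1)}\rho\,\sigma_-^{(1)}-\{n_-^{(1)},\rho\}\bigr]+2\beta_1\bigl[2\sigma_-^{(1)}\rho\,\sigma_+^{(1)}-\{n_+^{(1)},\rho\}\bigr]\\&+2\beta_0'\bigl[2\sigma_+^{(N)}\rho\,\sigma_-^{(N)}-\{n_-^{(N)},\rho\}\bigr]+2\beta_1'\bigl[2\sigma_-^{(N)}\rho\,\sigma_+^{(N)}-\{n_+^{(N)},\rho\}\bigr].\end{aligned}$$ A (normal) state is a positive semidefinite $\rho\in\mathcal B(\mathcal H_S)$ with $\mathrm{Tr}\,\rho=1$. It is faithful if $\mathrm{Tr}(\rho A^*A)=0$ implies $A=0$, and stationary if $e^{t\mathcal L^*}\rho=\rho$ for all $t\ge0$. Then there is exactly one stationary state $\rho^{\beta,\beta'}$; it is faithful, and the semigroup $(e^{t\mathcal L^*})_{t\ge0}$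 approaches equilibrium: $$\lim_{t\to\infty}\mathrm{Tr}\bigl(e^{t\mathcal L^*}(\xi)\,A\bigr)=\mathrm{Tr}\bigl(\rho^{\beta,\beta'}A\bigr)\quad\text{for every state }\xi\text{ and every }A\in\mathcal B(\mathcal H_S).$$ -/

import Mathlib

open scoped ComplexOrder Matrix.Norms.L2Operator

noncomputable section

namespace SpinChain

/-- Operators on one spin `ℂ²`; index `0` is the basis vector `(1,0)`, index `1` is `(0,1)`. -/
abbrev SpinOp : Type := Matrix (Fin 2) (Fin 2) ℂ

/-- Operators on `⊗_{k=1}^N ℂ²`, as matrices in the product basis, which is indexed by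
`Fin N → Fin 2`.  Site `k ∈ {1, …, N}` is the element `k - 1` of `Fin N`. -/
abbrev ChainOp (N : ℕ) : Type := Matrix (Fin N → Fin 2) (Fin N → Fin 2) ℂ

def sigmaX : SpinOp := !![0, 1; 1, 0]

def sigmaY : SpinOp := !![0, -Complex.I; Complex.I, 0]

def sigmaZ : SpinOp := !![1, 0; 0, -1]

def sigmaPlus : SpinOp := !![0, 1; 0, 0]

def sigmaMinus : SpinOp := !![0, 0; 1, 0]

def nPlus : SpinOp := !![1, 0; 0, 0]

def nMinus : SpinOp := !![0, 0; 0, 1]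

/-- The tensor product `a_1 ⊗ ⋯ ⊗ a_N` of one-spin operators (iterated Kronecker product). -/
def tensorOp {N : ℕ} (a : Fin N → SpinOp) : ChainOp N :=
  Matrix.of fun s t => ∏ j, a j (s j) (t j)

/-- `a^{(k)} = I ⊗ ⋯ ⊗ a ⊗ ⋯ ⊗ I`, with `a` acting at site `k`. -/
def siteOp {N : ℕ} (k : Fin N) (a : SpinOp) : ChainOp N :=
  tensorOp (Function.update (fun _ => 1) k a)

/-- The XY Hamiltonian
`H_S = ∑_{k=1}^N σ_z^{(k)} + ∑_{k=1}^{N-1} (σ_x^{(k)} σ_x^{(k+1)} + σ_y^{(k)} σ_y^{(k+1)})`. -/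
def hamiltonian (N : ℕ) : ChainOp N :=
  ∑ k : Fin N, siteOp k sigmaZ +
    ∑ k : Fin (N - 1),
      (siteOp ⟨k.val, by omega⟩ sigmaX * siteOp ⟨k.val + 1, by omega⟩ sigmaX +
        siteOp ⟨k.val, by omega⟩ sigmaY * siteOp ⟨k.val + 1, by omega⟩ sigmaY)

/-- The upper diagonal entry `β₀` of `ρ_β = e^{-β σ_z} / Tr e^{-β σ_z} = diag (β₀, β₁)`. -/
def gibbs0 (β : ℝ) : ℝ := Real.exp (-β) / (Real.exp (-β) + Real.exp β)

/-- The lower diagonal entry `β₁` of `ρ_β = e^{-β σ_z} / Tr e^{-β σ_z} = diag (β₀, β₁)`. -/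
def gibbs1 (β : ℝ) : ℝ := Real.exp β / (Real.exp (-β) + Real.exp β)

/-- The Hamiltonian part `ρ ↦ -i [H_S, ρ]` of the master equation. -/
def hamiltonianPart (N : ℕ) : ChainOp N →ₗ[ℂ] ChainOp N where
  toFun ρ := -Complex.I • (hamiltonian N * ρ - ρ * hamiltonian N)
  map_add' ρ τ := by
    rw [← smul_add]; congr 1; noncomm_ring
  map_smul' c ρ := by
    simp only [Matrix.mul_smul, Matrix.smul_mul, ← smul_sub, RingHom.id_apply]
    rw [smul_comm]

/-- The dissipative part of the master equation that is due to a heat bath at inverse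
temperature `β` coupled to site `k`:
`ρ ↦ 2 β₀ [2 σ₊^{(k)} ρ σ₋^{(k)} - {n₋^{(k)}, ρ}] + 2 β₁ [2 σ₋^{(k)} ρ σ₊^{(k)} - {n₊^{(k)}, ρ}]`. -/
def bathPart {N : ℕ} (k : Fin N) (β : ℝ) : ChainOp N →ₗ[ℂ] ChainOp N where
  toFun ρ :=
    (2 * gibbs0 β : ℂ) • ((2 : ℂ) • (siteOp k sigmaPlus * ρ * siteOp k sigmaMinus) -
        (siteOp k nMinus * ρ + ρ * siteOp k nMinus)) +
      (2 * gibbs1 β : ℂ) • ((2 : ℂ) • (siteOp k sigmaMinus * ρ * siteOp k sigmaPlus) -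
        (siteOp k nPlus * ρ + ρ * siteOp k nPlus))
  map_add' ρ τ := by
    simp only [mul_add, add_mul, smul_add, smul_sub]; abel
  map_smul' c ρ := by
    simp only [Matrix.mul_smul, Matrix.smul_mul, RingHom.id_apply]
    module

/-- The generator `ℒ*` of the quantum master equation of the chain of `N ≥ 1` spins whose
first site is coupled to a bath at inverse temperature `β` and whose `N`-th site is coupled to
a bath at inverse temperature `β'`. -/
def masterGenerator (N : ℕ) (hN : 1 ≤ N) (β β' : ℝ) : ChainOp N →ₗ[ℂ] ChainOp N :=
  hamiltonianPart N + bathPart ⟨0, by omega⟩ β + bathPart ⟨N - 1, by omega⟩ β'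

/-- `T_t^* = e^{t ℒ*}`, the exponential taken in the Banach algebra of bounded linear maps on
`B(H_S)`. -/
def semigroup (N : ℕ) (hN : 1 ≤ N) (β β' t : ℝ) : ChainOp N →L[ℂ] ChainOp N :=
  NormedSpace.exp ((t : ℂ) • LinearMap.toContinuousLinearMap (masterGenerator N hN β β'))

/-- Normal states on `B(H_S)`, as density matrices. -/
def IsState {N : ℕ} (ρ : ChainOp N) : Prop :=
  ρ.PosSemidef ∧ ρ.trace = 1

/-- The functional `A ↦ Tr (ρ A)` is faithful. -/
def IsFaithful {N : ℕ} (ρ : ChainOp N) : Prop :=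
  ∀ A : ChainOp N, (ρ * (A.conjTranspose * A)).trace = 0 → A = 0

/-- `ρ` is invariant under a one-parameter family `Θ_t^*`, `t ≥ 0`, of maps. -/
def IsStationary {N : ℕ} (Θ : ℝ → ChainOp N →L[ℂ] ChainOp N) (ρ : ChainOp N) : Prop :=
  ∀ t : ℝ, 0 ≤ t → Θ t ρ = ρ

/-- Approach to equilibrium: `lim_{t → ∞} Tr (Θ_t^*(ξ) A) = Tr (ρ A)` for all normal states `ξ`
and all operators `A`. -/
def ApproachesEquilibrium {N : ℕ} (Θ : ℝ → ChainOp N →L[ℂ] ChainOp N) (ρ : ChainOp N) : Prop :=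
  ∀ ξ : ChainOp N, IsState ξ → ∀ A : ChainOp N,
    Filter.Tendsto (fun t : ℝ => (Θ t ξ * A).trace) Filter.atTop (nhds (ρ * A).trace)

end SpinChain

end

/-!
The master equation is a Lindblad equation whose jump operators are `σ₊` and `σ₋` at the two end
sites, all with positive rates; in particular the set of jump operators is closed under adjoints.
Everything follows from one algebraic fact, `SpinChain.eq_top_of_lie_hamiltonian_mem`: a subalgebra
containing `σ₊` and `σ₋` at the first site and stable under `[H_S, ·]` contains every operator.
Indeed, the commutator of `H_S` with `σ_x` or `σ_y` at site `k` produces, modulo operators at the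
sites up to `k`, a multiple of `σ_z^{(k)} σ_y^{(k+1)}` or `σ_z^{(k)} σ_x^{(k+1)}`, so that the
algebra spreads along the chain.

*Existence* (`Matrix.exists_lindblad_eq_zero`). If no density matrix is annihilated by the
generator, Hahn-Banach yields a Hermitian `A` whose image under the Heisenberg generator `L` has
positive expectation in every state. In the state of an eigenvector of the largest eigenvalue `μ` of
`A` this expectation is nonpositive, because `L A = -L (μ - A)` and `μ - A` is positive and
annihilates the eigenvector.

*Faithfulness* (`Matrix.posDef_of_lindblad_eq_zero`). The kernel of a stationary density matrix is
invariant under the jump operators and the Hamiltonian, hence under all operators.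

*Convergence* (`Matrix.tendsto_exp_smul_lindbladDual`). For a stationary `ρ`, the dissipation
identity for `L (A* A)` shows that an eigenvector `A` of `L` with eigenvalue of nonnegative real
part commutes with the jump operators, and then is an eigenvector of `[H_S, ·]`. Its commutant is
stable under `[H_S, ·]`, so `A` is scalar and the eigenvalue is `0`. As `Tr (ρ L(A)) = 0`, the
eigenvalue `0` is semisimple. Thus `exp (t L) A` converges to a scalar, which has to be `Tr (ρ A)`;
by duality this is the approach to equilibrium, and uniqueness of the stationary state is a
consequence.
-/

/-! ### Long-time behaviour of `exp (t M)` in finite dimension -/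

section Exponential

variable {E : Type*} [NormedAddCommGroup E] [NormedSpace ℂ E] [CompleteSpace E]

theorem hasSum_exp_smul_apply (M : E →L[ℂ] E) (t : ℂ) (x : E) :
    HasSum (fun n : ℕ => ((n.factorial : ℂ)⁻¹ * t ^ n) • (M ^ n) x)
      (NormedSpace.exp (t • M) x) := by
  have h := (NormedSpace.exp_series_hasSum_exp' (𝕂 := ℂ) (t • M)).mapL
    (ContinuousLinearMap.apply ℂ E x)
  simpa [smul_pow, smul_smul] using h

theorem exp_smul_apply_of_pow_apply_eq_zero (M : E →L[ℂ] E) (t : ℂ) {x : E} {k : ℕ}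
    (h : (M ^ k) x = 0) :
    NormedSpace.exp (t • M) x =
      ∑ n ∈ Finset.range k, ((n.factorial : ℂ)⁻¹ * t ^ n) • (M ^ n) x := by
  refine (hasSum_exp_smul_apply M t x).unique (hasSum_sum_of_ne_finset_zero fun n hn => ?_)
  obtain ⟨m, rfl⟩ := Nat.exists_eq_add_of_le (not_lt.mp (Finset.mem_range.not.mp hn))
  rw [add_comm k m, pow_add M, mul_apply_eq_comp, h, map_zero, smul_zero]

theorem exp_smul_apply_of_apply_eq_zero (M : E →L[ℂ] E) (t : ℂ) {x : E} (h : M x = 0) :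
    NormedSpace.exp (t • M) x = x := by
  rw [exp_smul_apply_of_pow_apply_eq_zero (k := 1) M t (by simpa using h)]
  simp

theorem exp_smul_eq_smul_exp_sub (M : E →L[ℂ] E) (t μ : ℂ) :
    NormedSpace.exp (t • M) = Complex.exp (t * μ) • NormedSpace.exp (t • (M - μ • 1)) := by
  have hs : t • M = algebraMap ℂ (E →L[ℂ] E) (t * μ) + t • (M - μ • 1) := by
    rw [Algebra.algebraMap_eq_smul_one, smul_sub, smul_smul]
    abel
  let : NormedAlgebra ℚ (E →L[ℂ] E) := NormedAlgebra.restrictScalars ℚ ℂ _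
  rw [hs, NormedSpace.exp_add_of_commute (Algebra.commutes _ _), ← NormedSpace.algebraMap_exp_comm,
    ← Complex.exp_eq_exp_ℂ, ← Algebra.smul_def]

theorem tendsto_exp_mul_mul_pow {μ : ℂ} (hμ : μ.re < 0) (n : ℕ) :
    Filter.Tendsto (fun t : ℝ => Complex.exp (t * μ) * (t : ℂ) ^ n) Filter.atTop (nhds 0) := by
  rw [tendsto_zero_iff_norm_tendsto_zero]
  have h := tendsto_rpow_mul_exp_neg_mul_atTop_nhds_zero n (-μ.re) (by linarith)
  refine h.congr' ?_
  filter_upwards [Filter.eventually_ge_atTop 0] with t ht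
  rw [norm_mul, norm_pow, Complex.norm_exp, Complex.norm_real, Real.norm_of_nonneg ht,
    Real.rpow_natCast, mul_comm]
  congr 2
  simp
  ring

/-- The contribution of a generalized eigenvector whose eigenvalue has negative real part
decays: it is a polynomial in `t` times `exp (t μ)`. -/
theorem tendsto_exp_smul_apply_of_sub_pow_apply_eq_zero (M : E →L[ℂ] E) {μ : ℂ} (hμ : μ.re < 0)
    {x : E} {k : ℕ} (h : ((M - μ • 1) ^ k) x = 0) :
    Filter.Tendsto (fun t : ℝ => NormedSpace.exp ((t : ℂ) • M) x) Filter.atTop (nhds 0) := by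
  have hformula : ∀ t : ℝ, NormedSpace.exp ((t : ℂ) • M) x = ∑ n ∈ Finset.range k,
      (Complex.exp (t * μ) * (t : ℂ) ^ n) •
        ((n.factorial : ℂ)⁻¹ • ((M - μ • 1) ^ n) x) := by
    intro t
    rw [exp_smul_eq_smul_exp_sub M t μ, _root_.smul_apply,
      exp_smul_apply_of_pow_apply_eq_zero _ _ h, Finset.smul_sum]
    refine Finset.sum_congr rfl fun n _ => ?_
    rw [smul_smul, smul_smul]
    congr 1
    ring
  simp only [hformula]
  rw [show (0 : E) = ∑ n ∈ Finset.range k, (0 : ℂ) •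
    ((n.factorial : ℂ)⁻¹ • ((M - μ • 1) ^ n) x) by simp]
  exact tendsto_finsetSum _ fun n _ => (tendsto_exp_mul_mul_pow hμ n).smul_const _

/-- If every nonzero eigenvalue of `M` has negative real part and the eigenvalue `0` is
semisimple, then `exp (t M)` converges strongly, with limit in the kernel of `M`. -/
theorem exists_tendsto_exp_smul_apply [FiniteDimensional ℂ E] (M : E →L[ℂ] E)
    (hM : ∀ (μ : ℂ) (x : E), x ≠ 0 → M x = μ • x → μ = 0 ∨ μ.re < 0)
    (hker : ∀ x, M (M x) = 0 → M x = 0) (x : E) :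
    ∃ y, M y = 0 ∧
      Filter.Tendsto (fun t : ℝ => NormedSpace.exp ((t : ℂ) • M) x) Filter.atTop (nhds y) := by
  have hx : x ∈ ⨆ μ : ℂ, Module.End.maxGenEigenspace (M : Module.End ℂ E) μ := by
    rw [Module.End.iSup_maxGenEigenspace_eq_top]
    trivial
  refine Submodule.iSup_induction _
    (motive := fun x => ∃ y, M y = 0 ∧
      Filter.Tendsto (fun t : ℝ => NormedSpace.exp ((t : ℂ) • M) x) Filter.atTop (nhds y))
    hx (fun μ x hx => ?_) ⟨0, map_zero M, by simp⟩ ?_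
  · obtain ⟨k, hk⟩ := (Module.End.mem_maxGenEigenspace _ μ x).mp hx
    have hk' : ((M - μ • 1) ^ k) x = 0 := by
      rw [← hk, Module.End.pow_apply, ← ContinuousLinearMap.coe_coe,
        ContinuousLinearMap.toLinearMap_pow, Module.End.pow_apply]
      rfl
    clear hk hx
    by_cases hμ : μ.re < 0
    · exact ⟨0, map_zero M, tendsto_exp_smul_apply_of_sub_pow_apply_eq_zero M hμ hk'⟩
    · have hzero : M x = 0 := by
        induction k with
        | zero => rw [show x = 0 by simpa using hk', map_zero]
        | succ k ih =>
          by_cases hy : ((M - μ • 1) ^ k) x = 0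
          · exact ih hy
          · -- The last nonzero vector of the Jordan chain is an eigenvector, so `μ = 0`.
            have hev : M (((M - μ • 1) ^ k) x) = μ • ((M - μ • 1) ^ k) x := by
              rw [pow_succ', mul_apply_eq_comp] at hk'
              exact sub_eq_zero.mp hk'
            obtain rfl : μ = 0 := (hM μ _ hy hev).resolve_right hμ
            rw [zero_smul, sub_zero] at hk' hy
            cases k with
            | zero => simpa using hk'
            | succ m =>
              rw [pow_succ', pow_succ', mul_apply_eq_comp,
                mul_apply_eq_comp] at hk'
              rw [pow_succ', mul_apply_eq_comp] at hy
              exact absurd (hker _ hk') hy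
      refine ⟨x, hzero, tendsto_const_nhds.congr fun t => ?_⟩
      rw [exp_smul_apply_of_apply_eq_zero M _ hzero]
  · rintro x y ⟨a, ha, hxa⟩ ⟨b, hb, hyb⟩
    exact ⟨a + b, by rw [map_add, ha, hb, add_zero], by simpa using hxa.add hyb⟩

end Exponential

namespace Matrix

/-! ### Exponentials and the trace pairing -/

variable {n : Type*} [Fintype n] [DecidableEq n]

/-- Transposition for the pairing `(X, A) ↦ Tr (X A)` commutes with the exponential. -/
theorem trace_exp_smul_apply_mul {M L : Matrix n n ℂ →ₗ[ℂ] Matrix n n ℂ}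
    (h : ∀ X A, (M X * A).trace = (X * L A).trace) (t : ℂ) (X A : Matrix n n ℂ) :
    (NormedSpace.exp (t • LinearMap.toContinuousLinearMap M) X * A).trace =
      (X * NormedSpace.exp (t • LinearMap.toContinuousLinearMap L) A).trace := by
  set M' := LinearMap.toContinuousLinearMap M with hM'
  set L' := LinearMap.toContinuousLinearMap L with hL'
  have h' : ∀ X A, (M' X * A).trace = (X * L' A).trace := fun X A => by
    rw [hM', hL', LinearMap.coe_toContinuousLinearMap', LinearMap.coe_toContinuousLinearMap', h]
  have hpow : ∀ (k : ℕ) (X : Matrix n n ℂ), ((M' ^ k) X * A).trace = (X * (L' ^ k) A).trace := by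
    intro k
    induction k with
    | zero => simp
    | succ k ih =>
      intro X
      rw [pow_succ, mul_apply_eq_comp, ih, h', pow_succ', mul_apply_eq_comp]
  have h1 := (hasSum_exp_smul_apply M' t X).mapL (LinearMap.toContinuousLinearMap
    (traceLinearMap n ℂ ℂ ∘ₗ LinearMap.mulRight ℂ A))
  have h2 := (hasSum_exp_smul_apply L' t A).mapL (LinearMap.toContinuousLinearMap
    (traceLinearMap n ℂ ℂ ∘ₗ LinearMap.mulLeft ℂ X))
  have hterm : ∀ k : ℕ, (((k.factorial : ℂ)⁻¹ * t ^ k) • (M' ^ k) X * A).trace =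
      (X * ((k.factorial : ℂ)⁻¹ * t ^ k) • (L' ^ k) A).trace := fun k => by
    rw [Matrix.smul_mul, Matrix.mul_smul, trace_smul, trace_smul, hpow]
  exact h1.unique ((funext hterm : _ = _) ▸ h2)

theorem exp_smul_toContinuousLinearMap_apply_of_apply_eq_zero
    {M : Matrix n n ℂ →ₗ[ℂ] Matrix n n ℂ} (t : ℂ) {X : Matrix n n ℂ} (h : M X = 0) :
    NormedSpace.exp (t • LinearMap.toContinuousLinearMap M) X = X :=
  exp_smul_apply_of_apply_eq_zero _ t (by rw [LinearMap.coe_toContinuousLinearMap', h])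

/-! ### Density matrices -/

theorem PosDef.trace_mul_conjTranspose_mul_self_eq_zero_iff {ρ : Matrix n n ℂ} (hρ : ρ.PosDef)
    {A : Matrix n n ℂ} : (ρ * (Aᴴ * A)).trace = 0 ↔ A = 0 := by
  refine ⟨fun h => ?_, fun h => by simp [h]⟩
  rw [← mul_assoc, trace_mul_comm, ← mul_assoc,
    (hρ.posSemidef.mul_mul_conjTranspose_same A).trace_eq_zero_iff] at h
  have hv : ∀ v, Aᴴ *ᵥ v = 0 := by
    intro v
    by_contra hne
    have hpos := hρ.dotProduct_mulVec_pos hne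
    rw [star_mulVec, conjTranspose_conjTranspose, ← dotProduct_mulVec, mulVec_mulVec,
      mulVec_mulVec, h, zero_mulVec, dotProduct_zero] at hpos
    exact lt_irrefl _ hpos
  rw [← conjTranspose_eq_zero]
  exact ext_of_mulVec_single fun i => by rw [hv, zero_mulVec]

omit [DecidableEq n] in
theorem PosSemidef.trace_mul_conjTranspose_mul_self_nonneg {ρ : Matrix n n ℂ}
    (hρ : ρ.PosSemidef) (A : Matrix n n ℂ) : 0 ≤ (ρ * (Aᴴ * A)).trace := by
  rw [← mul_assoc, trace_mul_comm, ← mul_assoc]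
  exact (hρ.mul_mul_conjTranspose_same A).trace_nonneg

variable (n) in
/-- The set of density matrices: positive semidefinite of trace one. -/
def densityMatrices : Set (Matrix n n ℂ) := {ρ | ρ.PosSemidef ∧ ρ.trace = 1}

omit [DecidableEq n] in
theorem convex_densityMatrices : Convex ℝ (densityMatrices n) := by
  rintro ρ ⟨hρ, hρ1⟩ τ ⟨hτ, hτ1⟩ a b ha hb hab
  refine ⟨(hρ.smul ha).add (hτ.smul hb), ?_⟩
  rw [trace_add, trace_smul, trace_smul, hρ1, hτ1, ← add_smul, hab, one_smul]

open scoped MatrixOrder in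
/-- Density matrices are the `Bᴴ B` with `B` in the Hilbert-Schmidt unit sphere. -/
theorem isCompact_densityMatrices : IsCompact (densityMatrices n) := by
  have himage : densityMatrices n =
      (fun B : Matrix n n ℂ => Bᴴ * B) '' {B | (Bᴴ * B).trace = 1} := by
    ext ρ
    constructor
    · rintro ⟨hρ, hρ1⟩
      obtain ⟨B, rfl⟩ := CStarAlgebra.nonneg_iff_eq_star_mul_self.mp hρ.nonneg
      exact ⟨B, hρ1, rfl⟩
    · rintro ⟨B, hB, rfl⟩
      exact ⟨posSemidef_conjTranspose_mul_self B, hB⟩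
  have hcont : Continuous fun B : Matrix n n ℂ => Bᴴ * B :=
    continuous_id.matrix_conjTranspose.mul continuous_id
  rw [himage]
  refine IsCompact.image ?_ hcont
  refine IsCompact.of_isClosed_subset
    (isCompact_univ_pi fun _ : n => isCompact_univ_pi fun _ : n => isCompact_closedBall (0 : ℂ) 1)
    (isClosed_eq hcont.matrix_trace continuous_const) ?_
  intro B hB i _ j _
  rw [mem_closedBall_zero_iff]
  have hsum : ∑ j, ∑ i, ‖B i j‖ ^ 2 = 1 := by
    have : (∑ j, ∑ i, ((‖B i j‖ ^ 2 : ℝ) : ℂ)) = 1 := by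
      rw [← show (Bᴴ * B).trace = 1 from hB]
      simp only [trace, diag_apply, mul_apply, conjTranspose_apply]
      refine Finset.sum_congr rfl fun j _ => Finset.sum_congr rfl fun i _ => ?_
      rw [Complex.ofReal_pow, ← Complex.conj_mul']
      rfl
    exact_mod_cast this
  have h1 : ‖B i j‖ ^ 2 ≤ 1 := by
    rw [← hsum]
    refine le_trans ?_ (Finset.single_le_sum
      (f := fun j => ∑ i, ‖B i j‖ ^ 2) (fun j _ => by positivity) (Finset.mem_univ j))
    exact Finset.single_le_sum (f := fun i => ‖B i j‖ ^ 2) (fun i _ => by positivity)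
      (Finset.mem_univ i)
  exact (sq_le_one_iff₀ (norm_nonneg _)).mp h1

/-- A Hermitian matrix attains its numerical maximum `μ` at a unit eigenvector. -/
theorem IsHermitian.exists_posSemidef_smul_one_sub [Nonempty n] {A : Matrix n n ℂ}
    (hA : A.IsHermitian) :
    ∃ (μ : ℝ) (v : n → ℂ), v ⬝ᵥ star v = 1 ∧ ((μ : ℂ) • (1 : Matrix n n ℂ) - A).PosSemidef ∧
      ((μ : ℂ) • (1 : Matrix n n ℂ) - A) *ᵥ v = 0 := by
  obtain ⟨i, hi⟩ := Finite.exists_max hA.eigenvalues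
  refine ⟨hA.eigenvalues i, (hA.eigenvectorBasis i).ofLp, ?_, ?_, ?_⟩
  · have h := hA.eigenvectorBasis.orthonormal.1 i
    have h2 := inner_self_eq_norm_sq_to_K (𝕜 := ℂ) (hA.eigenvectorBasis i)
    rw [h, EuclideanSpace.inner_eq_star_dotProduct] at h2
    simpa using h2
  · have hspec : (hA.eigenvalues i : ℂ) • (1 : Matrix n n ℂ) - A =
        (hA.eigenvectorUnitary : Matrix n n ℂ) *
          diagonal (fun j => ((hA.eigenvalues i - hA.eigenvalues j : ℝ) : ℂ)) *
          (hA.eigenvectorUnitary : Matrix n n ℂ)ᴴ := by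
      have hd : diagonal (fun j => ((hA.eigenvalues i - hA.eigenvalues j : ℝ) : ℂ)) =
          (hA.eigenvalues i : ℂ) • (1 : Matrix n n ℂ) -
            diagonal (RCLike.ofReal ∘ hA.eigenvalues) := by
        rw [smul_one_eq_diagonal, diagonal_sub]
        simp
      have hu : (hA.eigenvectorUnitary : Matrix n n ℂ) *
          (hA.eigenvectorUnitary : Matrix n n ℂ)ᴴ = 1 :=
        Unitary.coe_mul_star_self _
      have hs := hA.spectral_theorem
      rw [Unitary.conjStarAlgAut_apply] at hs
      rw [hd, mul_sub, sub_mul, Matrix.mul_smul, Matrix.smul_mul, mul_one, hu]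
      congr 1
    rw [hspec]
    refine (PosSemidef.diagonal fun j => ?_).mul_mul_conjTranspose_same _
    simpa using hi j
  · rw [sub_mulVec, hA.mulVec_eigenvectorBasis, smul_mulVec, one_mulVec, sub_eq_zero]
    rfl

end Matrix

namespace Matrix

variable {n ι : Type*} [Fintype n] [DecidableEq n] [Fintype ι]

/-! ### Lindblad generators -/

/-- The Lindblad generator (Schrödinger picture) with Hamiltonian `H`, jump operators `V j` and
rates `c j`,
`ρ ↦ -i [H, ρ] + ∑ j, c j (2 V j ρ (V j)ᴴ - {(V j)ᴴ V j, ρ})`. -/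
noncomputable def lindblad (H : Matrix n n ℂ) (c : ι → ℝ) (V : ι → Matrix n n ℂ) :
    Matrix n n ℂ →ₗ[ℂ] Matrix n n ℂ :=
  -Complex.I • (LinearMap.mulLeft ℂ H - LinearMap.mulRight ℂ H) +
    ∑ j, (c j : ℂ) • ((2 : ℂ) • (LinearMap.mulLeft ℂ (V j) ∘ₗ LinearMap.mulRight ℂ (V j)ᴴ) -
      (LinearMap.mulLeft ℂ ((V j)ᴴ * V j) + LinearMap.mulRight ℂ ((V j)ᴴ * V j)))

/-- The Heisenberg-picture counterpart of `Matrix.lindblad`: its transpose for the pairing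
`(X, A) ↦ Tr (X A)`. -/
noncomputable def lindbladDual (H : Matrix n n ℂ) (c : ι → ℝ) (V : ι → Matrix n n ℂ) :
    Matrix n n ℂ →ₗ[ℂ] Matrix n n ℂ :=
  Complex.I • (LinearMap.mulLeft ℂ H - LinearMap.mulRight ℂ H) +
    ∑ j, (c j : ℂ) • ((2 : ℂ) • (LinearMap.mulLeft ℂ (V j)ᴴ ∘ₗ LinearMap.mulRight ℂ (V j)) -
      (LinearMap.mulLeft ℂ ((V j)ᴴ * V j) + LinearMap.mulRight ℂ ((V j)ᴴ * V j)))

variable {H : Matrix n n ℂ} {c : ι → ℝ} {V : ι → Matrix n n ℂ}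

theorem lindblad_apply (X : Matrix n n ℂ) :
    lindblad H c V X = -Complex.I • (H * X - X * H) +
      ∑ j, (c j : ℂ) • ((2 : ℂ) • (V j * X * (V j)ᴴ) -
        ((V j)ᴴ * V j * X + X * ((V j)ᴴ * V j))) := by
  simp [lindblad, mul_assoc]

theorem lindbladDual_apply (A : Matrix n n ℂ) :
    lindbladDual H c V A = Complex.I • (H * A - A * H) +
      ∑ j, (c j : ℂ) • ((2 : ℂ) • ((V j)ᴴ * A * V j) -
        ((V j)ᴴ * V j * A + A * ((V j)ᴴ * V j))) := by
  simp [lindbladDual, mul_assoc]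

theorem trace_lindblad_mul (X A : Matrix n n ℂ) :
    (lindblad H c V X * A).trace = (X * lindbladDual H c V A).trace := by
  rw [lindblad_apply, lindbladDual_apply]
  simp only [add_mul, mul_add, Matrix.sum_mul, Matrix.mul_sum, Matrix.smul_mul, Matrix.mul_smul,
    sub_mul, mul_sub, trace_add, trace_sum, trace_smul, trace_sub]
  have hcyc : ∀ B : Matrix n n ℂ, (B * X * A).trace = (X * (A * B)).trace := fun B => by
    rw [trace_mul_cycle, trace_mul_comm]
  have hV : ∀ j, (V j * X * (V j)ᴴ * A).trace = (X * ((V j)ᴴ * A * V j)).trace := fun j => by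
    rw [mul_assoc, mul_assoc, trace_mul_comm, mul_assoc]
  simp only [hcyc, hV, mul_assoc X]
  congr 1
  · simp only [smul_eq_mul]; ring
  · refine Finset.sum_congr rfl fun j _ => ?_
    congr 2
    rw [add_comm]

theorem lindbladDual_one : lindbladDual H c V 1 = 0 := by
  rw [lindbladDual_apply]
  simp [two_smul]

theorem conjTranspose_lindblad (hH : H.IsHermitian) (X : Matrix n n ℂ) :
    (lindblad H c V X)ᴴ = lindblad H c V Xᴴ := by
  rw [lindblad_apply, lindblad_apply]
  simp only [conjTranspose_add, conjTranspose_sum, conjTranspose_smul, conjTranspose_sub,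
    conjTranspose_mul, conjTranspose_conjTranspose, hH.eq]
  congr 1
  · simp only [star_neg, Complex.star_def, Complex.conj_I, neg_neg]
    rw [neg_smul, ← smul_neg, neg_sub]
  · refine Finset.sum_congr rfl fun j _ => ?_
    simp only [Complex.star_def, Complex.conj_ofReal, mul_assoc, map_ofNat]
    rw [add_comm]

theorem conjTranspose_lindbladDual (hH : H.IsHermitian) (A : Matrix n n ℂ) :
    (lindbladDual H c V A)ᴴ = lindbladDual H c V Aᴴ := by
  rw [lindbladDual_apply, lindbladDual_apply]
  simp only [conjTranspose_add, conjTranspose_sum, conjTranspose_smul, conjTranspose_sub,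
    conjTranspose_mul, conjTranspose_conjTranspose, hH.eq]
  congr 1
  · simp only [Complex.star_def, Complex.conj_I]
    rw [neg_smul, ← smul_neg, neg_sub]
  · refine Finset.sum_congr rfl fun j _ => ?_
    simp only [Complex.star_def, Complex.conj_ofReal, mul_assoc, map_ofNat]
    rw [add_comm]

/-- The dissipation identity: the defect of `lindbladDual` from being a derivation is a positive
combination of the squares of the commutators `[V j, A]`. -/
theorem lindbladDual_conjTranspose_mul_self (hH : H.IsHermitian) (A : Matrix n n ℂ) :
    lindbladDual H c V (Aᴴ * A) - (lindbladDual H c V A)ᴴ * A - Aᴴ * lindbladDual H c V A =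
      ∑ j, (2 * c j : ℂ) • ((V j * A - A * V j)ᴴ * (V j * A - A * V j)) := by
  rw [conjTranspose_lindbladDual hH]
  simp only [lindbladDual_apply, add_mul, mul_add, Finset.sum_mul, Finset.mul_sum]
  have hI : Complex.I • (H * (Aᴴ * A) - Aᴴ * A * H) - Complex.I • (H * Aᴴ - Aᴴ * H) * A -
      Aᴴ * Complex.I • (H * A - A * H) = 0 := by
    simp only [Matrix.smul_mul, Matrix.mul_smul, sub_mul, mul_sub, mul_assoc, smul_sub]
    abel
  rw [add_sub_add_comm, add_sub_add_comm, hI, zero_add, ← Finset.sum_sub_distrib,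
    ← Finset.sum_sub_distrib]
  refine Finset.sum_congr rfl fun j _ => ?_
  simp only [Matrix.smul_mul, Matrix.mul_smul, sub_mul, mul_sub, add_mul, mul_add, mul_assoc,
    conjTranspose_sub, conjTranspose_mul]
  module

/-- If `B ≥ 0` annihilates `v`, then `lindbladDual B` has nonnegative expectation in `v`: only
the terms `(V j)ᴴ B (V j)` survive. -/
theorem PosSemidef.dotProduct_lindbladDual_mulVec_nonneg (hc : ∀ j, 0 ≤ c j)
    {B : Matrix n n ℂ} (hB : B.PosSemidef) {v : n → ℂ} (hv : B *ᵥ v = 0) :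
    0 ≤ star v ⬝ᵥ lindbladDual H c V B *ᵥ v := by
  have hv' : ∀ C : Matrix n n ℂ, star v ⬝ᵥ (B * C) *ᵥ v = 0 := fun C => by
    rw [← mulVec_mulVec, dotProduct_mulVec, ← hB.isHermitian.eq, ← star_mulVec, hv, star_zero,
      zero_dotProduct]
  have hv'' : ∀ C : Matrix n n ℂ, star v ⬝ᵥ (C * B) *ᵥ v = 0 := fun C => by
    rw [← mulVec_mulVec, hv, mulVec_zero, dotProduct_zero]
  rw [lindbladDual_apply]
  simp only [add_mulVec, sub_mulVec, smul_mulVec, sum_mulVec, dotProduct_add, dotProduct_sub,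
    dotProduct_smul, dotProduct_sum, hv', hv'', sub_zero, add_zero, smul_zero, zero_add]
  refine Finset.sum_nonneg fun j _ => ?_
  refine smul_nonneg (by exact_mod_cast hc j) (smul_nonneg (by norm_num) ?_)
  exact (hB.conjTranspose_mul_mul_same (V j)).dotProduct_mulVec_nonneg v

/-! ### Stationary density matrices -/

theorem exists_forall_eq_trace_mul (f : Matrix n n ℂ →ₗ[ℂ] ℂ) :
    ∃ A : Matrix n n ℂ, ∀ X, f X = (X * A).trace := by
  refine ⟨of fun i j => f (single j i 1), fun X => ?_⟩
  conv_lhs => rw [matrix_eq_sum_single X]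
  simp only [map_sum, trace, diag_apply, mul_apply, of_apply]
  refine Finset.sum_congr rfl fun i _ => Finset.sum_congr rfl fun j _ => ?_
  rw [← smul_eq_mul, ← map_smul, smul_single, smul_eq_mul, mul_one]

/-- Existence of a stationary density matrix. Otherwise `0` is strictly separated from the compact
convex image of the density matrices by some Hermitian `A`, i.e. `lindbladDual A` has positive
expectation in every state; this fails in the state of a top eigenvector of `A`. -/
theorem exists_lindblad_eq_zero [Nonempty n] (hH : H.IsHermitian) (hc : ∀ j, 0 ≤ c j) :
    ∃ ρ ∈ densityMatrices n, lindblad H c V ρ = 0 := by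
  by_contra hne
  have hcomp : IsCompact (lindblad H c V '' densityMatrices n) :=
    isCompact_densityMatrices.image (lindblad H c V).continuous_of_finiteDimensional
  have hconv : Convex ℝ (lindblad H c V '' densityMatrices n) :=
    convex_densityMatrices.linear_image ((lindblad H c V).restrictScalars ℝ)
  obtain ⟨f, u, hu0, hu⟩ := RCLike.geometric_hahn_banach_point_closed (𝕜 := ℂ)
    (x := (0 : Matrix n n ℂ)) hconv hcomp.isClosed hne
  rw [map_zero, map_zero] at hu0
  obtain ⟨A, hA⟩ := exists_forall_eq_trace_mul (f : Matrix n n ℂ →ₗ[ℂ] ℂ)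
  -- On Hermitian matrices `Re f` is the pairing with the Hermitian matrix `A + Aᴴ`, up to `1/2`.
  have hsymm : ∀ X : Matrix n n ℂ, X.IsHermitian →
      ((X * (A + Aᴴ)).trace).re = 2 * (f X).re := by
    intro X hX
    have h1 : f X = (X * A).trace := hA X
    have h2 : (X * Aᴴ).trace = star (X * A).trace := by
      rw [← trace_conjTranspose, conjTranspose_mul, hX.eq, trace_mul_comm]
    rw [mul_add, trace_add, h2, h1, Complex.add_re, Complex.star_def, Complex.conj_re]
    ring
  have hAA : (A + Aᴴ).IsHermitian := isHermitian_add_transpose_self A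
  obtain ⟨μ, v, hv1, hB, hBv⟩ := hAA.exists_posSemidef_smul_one_sub
  have hρ : vecMulVec v (star v) ∈ densityMatrices n :=
    ⟨posSemidef_vecMulVec_self_star v, by rw [trace_vecMulVec, hv1]⟩
  have hpos : 0 < (f (lindblad H c V (vecMulVec v (star v)))).re :=
    hu0.trans (hu _ ⟨_, hρ, rfl⟩)
  have hherm : (lindblad H c V (vecMulVec v (star v))).IsHermitian := by
    rw [IsHermitian, conjTranspose_lindblad hH, hρ.1.isHermitian.eq]
  have hnn := hB.dotProduct_lindbladDual_mulVec_nonneg (H := H) (V := V) hc hBv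
  rw [map_sub, map_smul, lindbladDual_one, smul_zero, zero_sub, neg_mulVec, dotProduct_neg] at hnn
  have hre := (Complex.nonneg_iff.mp hnn).1
  have heq : (vecMulVec v (star v) * lindbladDual H c V (A + Aᴴ)).trace =
      star v ⬝ᵥ lindbladDual H c V (A + Aᴴ) *ᵥ v := by
    rw [trace_mul_comm, mul_vecMulVec, trace_vecMulVec, dotProduct_comm]
  have h2 := hsymm _ hherm
  rw [trace_lindblad_mul, heq] at h2
  rw [Complex.neg_re] at hre
  linarith

/-- The matrices that leave the kernel of `ρ` invariant. -/
def kerStabilizer (ρ : Matrix n n ℂ) : Subalgebra ℂ (Matrix n n ℂ) where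
  carrier := {X | ∀ v, ρ *ᵥ v = 0 → ρ *ᵥ (X *ᵥ v) = 0}
  mul_mem' {X Y} hX hY v hv := by
    rw [← mulVec_mulVec]
    exact hX _ (hY v hv)
  add_mem' {X Y} hX hY v hv := by
    rw [add_mulVec, mulVec_add, hX v hv, hY v hv, add_zero]
  algebraMap_mem' r v hv := by
    rw [Algebra.algebraMap_eq_smul_one, smul_mulVec, one_mulVec, mulVec_smul, hv, smul_zero]

theorem eq_zero_of_kerStabilizer_eq_top {ρ : Matrix n n ℂ} (h : kerStabilizer ρ = ⊤)
    {v : n → ℂ} (hv0 : v ≠ 0) (hv : ρ *ᵥ v = 0) : ρ = 0 := by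
  obtain ⟨i, hi⟩ := Function.ne_iff.mp hv0
  refine ext_of_mulVec_single fun j => ?_
  have hmem : single j i (v i)⁻¹ ∈ kerStabilizer ρ := h ▸ Algebra.mem_top
  have hX : single j i (v i)⁻¹ *ᵥ v = Pi.single j 1 := by
    rw [single_mulVec, inv_mul_cancel₀ hi]
    rfl
  rw [← hX, hmem v hv, zero_mulVec]

/-- A stationary density matrix is positive definite: its kernel is invariant under the adjoints
of the jump operators, hence under the Hamiltonian, hence under all matrices. -/
theorem posDef_of_lindblad_eq_zero (hc : ∀ j, 0 < c j)
    (hstar : ∀ j, ∃ k, V k = (V j)ᴴ)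
    (hgen : ∀ S : Subalgebra ℂ (Matrix n n ℂ), (∀ j, V j ∈ S) →
      (∀ X ∈ S, H * X - X * H ∈ S) → S = ⊤)
    {ρ : Matrix n n ℂ} (hρ : ρ ∈ densityMatrices n) (h0 : lindblad H c V ρ = 0) :
    ρ.PosDef := by
  have hVstar : ∀ j v, ρ *ᵥ v = 0 → ρ *ᵥ ((V j)ᴴ *ᵥ v) = 0 := by
    intro j v hv
    have hterm : ∀ k, 0 ≤ star v ⬝ᵥ (V k * ρ * (V k)ᴴ) *ᵥ v := fun k =>
      (hρ.1.mul_mul_conjTranspose_same (V k)).dotProduct_mulVec_nonneg v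
    have hv' : ∀ C : Matrix n n ℂ, star v ⬝ᵥ (ρ * C) *ᵥ v = 0 := fun C => by
      rw [← mulVec_mulVec, dotProduct_mulVec, ← hρ.1.isHermitian.eq, ← star_mulVec, hv, star_zero,
        zero_dotProduct]
    have hv'' : ∀ C : Matrix n n ℂ, star v ⬝ᵥ (C * ρ) *ᵥ v = 0 := fun C => by
      rw [← mulVec_mulVec, hv, mulVec_zero, dotProduct_zero]
    have hsum : star v ⬝ᵥ lindblad H c V ρ *ᵥ v = 0 := by rw [h0, zero_mulVec, dotProduct_zero]
    rw [lindblad_apply] at hsum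
    simp only [add_mulVec, sub_mulVec, smul_mulVec, sum_mulVec, dotProduct_add, dotProduct_sub,
      dotProduct_smul, dotProduct_sum, hv', hv'', sub_zero, add_zero, smul_zero, zero_add] at hsum
    have hj := (Finset.sum_eq_zero_iff_of_nonneg fun k _ =>
      smul_nonneg (by exact_mod_cast (hc k).le : (0 : ℂ) ≤ c k)
        (smul_nonneg (by norm_num : (0 : ℂ) ≤ 2) (hterm k))).mp hsum j (Finset.mem_univ j)
    have hcj : (c j : ℂ) ≠ 0 := by exact_mod_cast (hc j).ne'
    rw [smul_eq_zero_iff_right hcj, smul_eq_zero_iff_right two_ne_zero, ← mulVec_mulVec,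
      ← mulVec_mulVec, dotProduct_mulVec, ← conjTranspose_conjTranspose (V j), ← star_mulVec,
      conjTranspose_conjTranspose] at hj
    exact (hρ.1.dotProduct_mulVec_zero_iff _).mp hj
  have hV : ∀ j, V j ∈ kerStabilizer ρ := by
    intro j
    obtain ⟨k, hk⟩ := hstar j
    intro v hv
    rw [← conjTranspose_conjTranspose (V j), ← hk]
    exact hVstar k v hv
  have hHS : H ∈ kerStabilizer ρ := by
    intro v hv
    have h : lindblad H c V ρ *ᵥ v = 0 := by rw [h0, zero_mulVec]
    have h1 : ∀ C : Matrix n n ℂ, (C * ρ) *ᵥ v = 0 := fun C => by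
      rw [← mulVec_mulVec, hv, mulVec_zero]
    have h2 : ∀ j, (V j * ρ * (V j)ᴴ) *ᵥ v = 0 := fun j => by
      rw [← mulVec_mulVec, ← mulVec_mulVec, hVstar j v hv, mulVec_zero]
    have h3 : ∀ j, (ρ * ((V j)ᴴ * V j)) *ᵥ v = 0 := fun j => by
      rw [← mulVec_mulVec, ← mulVec_mulVec]
      exact hVstar j _ (hV j v hv)
    rw [lindblad_apply] at h
    simpa [add_mulVec, sub_mulVec, smul_mulVec, sum_mulVec, h1, h2, h3, neg_mulVec] using h
  have htop := hgen (kerStabilizer ρ) hV fun X hX => sub_mem (mul_mem hHS hX) (mul_mem hX hHS)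
  refine PosDef.of_dotProduct_mulVec_pos hρ.1.isHermitian fun v hv0 => ?_
  refine lt_of_le_of_ne (hρ.1.dotProduct_mulVec_nonneg v) fun hzero => ?_
  have hker := (hρ.1.dotProduct_mulVec_zero_iff v).mp hzero.symm
  have := hρ.2
  rw [eq_zero_of_kerStabilizer_eq_top htop hv0 hker, trace_zero] at this
  exact zero_ne_one this

/-! ### The spectrum of the Heisenberg generator -/

omit [Fintype ι] in
/-- An operator that commutes with the jump operators and is an eigenvector of `[H, ·]` is scalar,
because its commutant is stable under `[H, ·]`. -/
theorem exists_eq_smul_one_of_commute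
    (hgen : ∀ S : Subalgebra ℂ (Matrix n n ℂ), (∀ j, V j ∈ S) →
      (∀ X ∈ S, H * X - X * H ∈ S) → S = ⊤)
    {A : Matrix n n ℂ} (hV : ∀ j, V j * A = A * V j) {ω : ℂ} (hA : H * A - A * H = ω • A) :
    ∃ z : ℂ, A = z • 1 := by
  have htop := hgen (Subalgebra.centralizer ℂ {A})
    (fun j => Subalgebra.mem_centralizer_iff ℂ |>.mpr fun B hB => by
      rw [Set.mem_singleton_iff.mp hB, hV])
    (fun X hX => by
      rw [Subalgebra.mem_centralizer_iff] at hX ⊢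
      rintro B rfl
      have hX := hX B rfl
      have hHA : H * B = B * H + ω • B := by rw [← hA]; abel
      rw [mul_sub, sub_mul, mul_assoc X, hHA, mul_add, ← mul_assoc, ← mul_assoc, mul_assoc H X B,
        ← hX, ← mul_assoc H, hHA, add_mul, Matrix.smul_mul, Matrix.mul_smul, hX]
      rw [← mul_assoc X, ← hX]
      abel)
  have hcomm : ∀ X : Matrix n n ℂ, A * X = X * A := fun X => by
    have hX : X ∈ Subalgebra.centralizer ℂ {A} := htop ▸ Algebra.mem_top
    exact (Subalgebra.mem_centralizer_iff ℂ).mp hX A rfl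
  obtain ⟨z, hz⟩ := mem_range_scalar_iff_commute_single'.mpr fun i j => (hcomm (single i j 1)).symm
  exact ⟨z, by rw [← hz, smul_one_eq_diagonal]; rfl⟩

/-- Peripheral eigenvalues of the Heisenberg generator: since the dissipation vanishes in the
faithful stationary state, an eigenvector `A` commutes with the jump operators and is scalar. -/
theorem re_neg_or_exists_eq_smul_one (hH : H.IsHermitian) (hc : ∀ j, 0 < c j)
    (hstar : ∀ j, ∃ k, V k = (V j)ᴴ)
    (hgen : ∀ S : Subalgebra ℂ (Matrix n n ℂ), (∀ j, V j ∈ S) →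
      (∀ X ∈ S, H * X - X * H ∈ S) → S = ⊤)
    {ρ : Matrix n n ℂ} (hρ : ρ.PosDef) (h0 : lindblad H c V ρ = 0) {A : Matrix n n ℂ}
    (hA0 : A ≠ 0) {μ : ℂ} (hA : lindbladDual H c V A = μ • A) :
    μ.re < 0 ∨ ∃ z : ℂ, A = z • 1 := by
  have hp := hρ.posSemidef.trace_mul_conjTranspose_mul_self_nonneg A
  have hp0 : (ρ * (Aᴴ * A)).trace ≠ 0 :=
    fun h => hA0 (hρ.trace_mul_conjTranspose_mul_self_eq_zero_iff.mp h)
  have hr : ∀ j, 0 ≤ (ρ * ((V j * A - A * V j)ᴴ * (V j * A - A * V j))).trace :=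
    fun j => hρ.posSemidef.trace_mul_conjTranspose_mul_self_nonneg _
  have hdiss : -(star μ + μ) * (ρ * (Aᴴ * A)).trace =
      ∑ j, (2 * c j : ℂ) * (ρ * ((V j * A - A * V j)ᴴ * (V j * A - A * V j))).trace := by
    have h := congrArg (fun X => (ρ * X).trace)
      (lindbladDual_conjTranspose_mul_self (c := c) (V := V) hH A)
    simp only [mul_sub ρ, trace_sub, ← trace_lindblad_mul, h0, zero_mul, trace_zero, hA,
      conjTranspose_smul, Matrix.smul_mul, Matrix.mul_smul, trace_smul, Matrix.mul_sum,
      trace_sum, smul_eq_mul] at h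
    rw [← h]
    ring
  have hterm : ∀ j, 0 ≤ (2 * c j : ℂ) *
      (ρ * ((V j * A - A * V j)ᴴ * (V j * A - A * V j))).trace := fun j =>
    mul_nonneg (by exact_mod_cast (mul_pos two_pos (hc j)).le) (hr j)
  by_cases hμ : μ.re < 0
  · exact Or.inl hμ
  right
  have hsum0 : ∑ j, (2 * c j : ℂ) *
      (ρ * ((V j * A - A * V j)ᴴ * (V j * A - A * V j))).trace = 0 := by
    refine le_antisymm ?_ (Finset.sum_nonneg fun j _ => hterm j)
    rw [← hdiss]
    have hre : (0 : ℂ) ≤ star μ + μ := by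
      rw [add_comm, Complex.star_def, Complex.add_conj]
      exact_mod_cast mul_nonneg zero_le_two (not_lt.mp hμ)
    rw [neg_mul]
    exact neg_nonpos.mpr (mul_nonneg hre hp)
  have hV : ∀ j, V j * A = A * V j := by
    intro j
    have h := (Finset.sum_eq_zero_iff_of_nonneg fun j _ => hterm j).mp hsum0 j (Finset.mem_univ j)
    have h2 : (2 * c j : ℂ) ≠ 0 := by exact_mod_cast (mul_pos two_pos (hc j)).ne'
    exact sub_eq_zero.mp (hρ.trace_mul_conjTranspose_mul_self_eq_zero_iff.mp
      ((mul_eq_zero.mp h).resolve_left h2))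
  have hVstar : ∀ j, (V j)ᴴ * A = A * (V j)ᴴ := fun j => by
    obtain ⟨k, hk⟩ := hstar j
    rw [← hk, hV]
  refine exists_eq_smul_one_of_commute hgen hV (ω := -Complex.I * μ) ?_
  have hham : lindbladDual H c V A = Complex.I • (H * A - A * H) := by
    rw [lindbladDual_apply, Finset.sum_eq_zero, add_zero]
    intro j _
    rw [mul_assoc _ A, ← hV, ← mul_assoc A, ← hVstar, mul_assoc _ A, ← hV, mul_assoc, two_smul,
      sub_self, smul_zero]
  rw [hham] at hA
  rw [mul_smul, ← hA, smul_smul, neg_mul, Complex.I_mul_I, neg_neg, one_smul]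

/-- Convergence in the Heisenberg picture: observables relax to their stationary expectation. -/
theorem tendsto_exp_smul_lindbladDual (hH : H.IsHermitian) (hc : ∀ j, 0 < c j)
    (hstar : ∀ j, ∃ k, V k = (V j)ᴴ)
    (hgen : ∀ S : Subalgebra ℂ (Matrix n n ℂ), (∀ j, V j ∈ S) →
      (∀ X ∈ S, H * X - X * H ∈ S) → S = ⊤)
    {ρ : Matrix n n ℂ} (hρ : ρ.PosDef) (hρ1 : ρ.trace = 1) (h0 : lindblad H c V ρ = 0)
    (A : Matrix n n ℂ) :
    Filter.Tendsto (fun t : ℝ => NormedSpace.exp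
        ((t : ℂ) • LinearMap.toContinuousLinearMap (lindbladDual H c V)) A)
      Filter.atTop (nhds ((ρ * A).trace • 1)) := by
  have hscalar : ∀ B, lindbladDual H c V B = 0 → ∃ z : ℂ, B = z • 1 := by
    intro B hB
    by_cases hB0 : B = 0
    · exact ⟨0, by rw [hB0, zero_smul]⟩
    · refine (re_neg_or_exists_eq_smul_one hH hc hstar hgen hρ h0 hB0 (μ := 0) ?_).resolve_left ?_
      · rw [hB, zero_smul]
      · simp
  have heig : ∀ (μ : ℂ) (B : Matrix n n ℂ), B ≠ 0 →
      LinearMap.toContinuousLinearMap (lindbladDual H c V) B = μ • B → μ = 0 ∨ μ.re < 0 := by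
    intro μ B hB0 hB
    rw [LinearMap.coe_toContinuousLinearMap'] at hB
    rcases re_neg_or_exists_eq_smul_one hH hc hstar hgen hρ h0 hB0 hB with h | ⟨z, rfl⟩
    · exact Or.inr h
    · left
      have h := hB
      rw [map_smul, lindbladDual_one, smul_zero] at h
      exact (smul_eq_zero.mp h.symm).resolve_right hB0
  have hker : ∀ B : Matrix n n ℂ, LinearMap.toContinuousLinearMap (lindbladDual H c V)
      (LinearMap.toContinuousLinearMap (lindbladDual H c V) B) = 0 →
        LinearMap.toContinuousLinearMap (lindbladDual H c V) B = 0 := by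
    intro B hB
    simp only [LinearMap.coe_toContinuousLinearMap'] at hB ⊢
    obtain ⟨z, hz⟩ := hscalar _ hB
    -- The stationary state annihilates the range of the generator, so `z = 0`.
    have h := trace_lindblad_mul (H := H) (c := c) (V := V) ρ B
    rw [h0, zero_mul, trace_zero, hz, Matrix.mul_smul, mul_one, trace_smul, hρ1, smul_eq_mul,
      mul_one] at h
    rw [hz, ← h, zero_smul]
  obtain ⟨B, hB, hlim⟩ := exists_tendsto_exp_smul_apply
    (LinearMap.toContinuousLinearMap (lindbladDual H c V)) heig hker A
  rw [LinearMap.coe_toContinuousLinearMap'] at hB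
  obtain ⟨z, rfl⟩ := hscalar B hB
  have hcont : Continuous fun X : Matrix n n ℂ => (ρ * X).trace :=
    (continuous_const.mul continuous_id).matrix_trace
  have hconst : ∀ t : ℝ, (ρ * NormedSpace.exp
      ((t : ℂ) • LinearMap.toContinuousLinearMap (lindbladDual H c V)) A).trace =
        (ρ * A).trace := by
    intro t
    rw [← trace_exp_smul_apply_mul (M := lindblad H c V) trace_lindblad_mul,
      exp_smul_toContinuousLinearMap_apply_of_apply_eq_zero _ h0]
  have h1 := (hcont.tendsto _).comp hlim
  simp only [Function.comp_def, hconst, Matrix.mul_smul, mul_one, trace_smul, hρ1,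
    smul_eq_mul] at h1
  rwa [tendsto_nhds_unique tendsto_const_nhds h1]

end Matrix

namespace SpinChain

/-! ### One-site operators -/

theorem tensorOp_mul {N : ℕ} (a b : Fin N → SpinOp) :
    tensorOp a * tensorOp b = tensorOp (fun j => a j * b j) := by
  ext s t
  simp only [tensorOp, Matrix.mul_apply, Matrix.of_apply, ← Finset.prod_mul_distrib]
  exact (Fintype.prod_sum fun j r => a j (s j) r * b j r (t j)).symm

theorem tensorOp_one {N : ℕ} : tensorOp (fun _ : Fin N => (1 : SpinOp)) = 1 := by
  ext s t
  simp only [tensorOp, Matrix.of_apply, Matrix.one_apply]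
  by_cases h : s = t
  · simp [h]
  · rw [if_neg h]
    obtain ⟨j, hj⟩ := Function.ne_iff.mp h
    exact Finset.prod_eq_zero (Finset.mem_univ j) (if_neg hj)

theorem siteOp_mul {N : ℕ} (k : Fin N) (a b : SpinOp) :
    siteOp k a * siteOp k b = siteOp k (a * b) := by
  rw [siteOp, siteOp, siteOp, tensorOp_mul]
  congr 1
  funext j
  by_cases h : j = k
  · subst h; simp
  · simp [Function.update_of_ne h]

theorem siteOp_commute {N : ℕ} {j k : Fin N} (h : j ≠ k) (a b : SpinOp) :
    Commute (siteOp j a) (siteOp k b) := by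
  rw [Commute, SemiconjBy, siteOp, siteOp, tensorOp_mul, tensorOp_mul]
  congr 1
  funext i
  by_cases hj : i = j
  · subst hj; simp [Function.update_of_ne h]
  · simp [Function.update_of_ne hj]

theorem siteOp_one {N : ℕ} (k : Fin N) : siteOp k 1 = 1 := by
  rw [siteOp, Function.update_eq_self_iff.mpr rfl, tensorOp_one]

theorem siteOp_apply {N : ℕ} (k : Fin N) (a : SpinOp) (s t : Fin N → Fin 2) :
    siteOp k a s t = a (s k) (t k) * ∏ j ∈ Finset.univ.erase k, (1 : SpinOp) (s j) (t j) := by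
  rw [siteOp, tensorOp, Matrix.of_apply, ← Finset.mul_prod_erase _ _ (Finset.mem_univ k)]
  congr 1
  · simp
  · exact Finset.prod_congr rfl fun j hj => by
      rw [Function.update_of_ne (Finset.ne_of_mem_erase hj)]

theorem siteOp_add {N : ℕ} (k : Fin N) (a b : SpinOp) :
    siteOp k (a + b) = siteOp k a + siteOp k b := by
  ext s t
  simp only [siteOp_apply, Matrix.add_apply, add_mul]

theorem siteOp_smul {N : ℕ} (k : Fin N) (c : ℂ) (a : SpinOp) :
    siteOp k (c • a) = c • siteOp k a := by
  ext s t
  simp only [siteOp_apply, Matrix.smul_apply, smul_eq_mul, mul_assoc]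

theorem conjTranspose_siteOp {N : ℕ} (k : Fin N) (a : SpinOp) :
    (siteOp k a).conjTranspose = siteOp k a.conjTranspose := by
  ext s t
  simp only [siteOp_apply, Matrix.conjTranspose_apply, star_mul', star_prod]
  congr 1
  refine Finset.prod_congr rfl fun j _ => ?_
  rw [← Matrix.conjTranspose_apply, Matrix.conjTranspose_one]

/-! ### The Pauli matrices -/

theorem conjTranspose_sigmaX : sigmaX.conjTranspose = sigmaX := by
  ext i j; fin_cases i <;> fin_cases j <;> simp [sigmaX]

theorem conjTranspose_sigmaY : sigmaY.conjTranspose = sigmaY := by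
  ext i j; fin_cases i <;> fin_cases j <;> simp [sigmaY]

theorem conjTranspose_sigmaZ : sigmaZ.conjTranspose = sigmaZ := by
  ext i j; fin_cases i <;> fin_cases j <;> simp [sigmaZ]

theorem conjTranspose_sigmaPlus : sigmaPlus.conjTranspose = sigmaMinus := by
  ext i j; fin_cases i <;> fin_cases j <;> simp [sigmaPlus, sigmaMinus]

theorem conjTranspose_sigmaMinus : sigmaMinus.conjTranspose = sigmaPlus := by
  rw [← conjTranspose_sigmaPlus, Matrix.conjTranspose_conjTranspose]

theorem sigmaMinus_mul_sigmaPlus : sigmaMinus * sigmaPlus = nMinus := by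
  ext i j; fin_cases i <;> fin_cases j <;> simp [sigmaPlus, sigmaMinus, nMinus]

theorem sigmaPlus_mul_sigmaMinus : sigmaPlus * sigmaMinus = nPlus := by
  ext i j; fin_cases i <;> fin_cases j <;> simp [sigmaPlus, sigmaMinus, nPlus]

theorem sigmaZ_mul_self : sigmaZ * sigmaZ = 1 := by
  simp [sigmaZ, Matrix.one_fin_two]

theorem sigmaX_mul_sigmaY : sigmaX * sigmaY = Complex.I • sigmaZ := by
  simp [sigmaX, sigmaY, sigmaZ]

theorem sigmaY_mul_sigmaX : sigmaY * sigmaX = -Complex.I • sigmaZ := by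
  simp [sigmaX, sigmaY, sigmaZ]

theorem gibbs0_pos (β : ℝ) : 0 < gibbs0 β := by unfold gibbs0; positivity

theorem gibbs1_pos (β : ℝ) : 0 < gibbs1 β := by unfold gibbs1; positivity

theorem conjTranspose_hamiltonian (N : ℕ) : (hamiltonian N).conjTranspose = hamiltonian N := by
  simp only [hamiltonian, Matrix.conjTranspose_add, Matrix.conjTranspose_sum,
    Matrix.conjTranspose_mul, conjTranspose_siteOp, conjTranspose_sigmaX, conjTranspose_sigmaY,
    conjTranspose_sigmaZ]
  congr 1
  refine Finset.sum_congr rfl fun k _ => ?_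
  have h : (⟨k.val + 1, by omega⟩ : Fin N) ≠ ⟨k.val, by omega⟩ := by simp
  rw [(siteOp_commute h sigmaX sigmaX).eq, (siteOp_commute h sigmaY sigmaY).eq]

/-! ### Operator algebras containing one-site operators -/

/-- The operators at one site are generated as an algebra by `σ₊` and `σ₋`. -/
theorem siteOp_mem_of_sigmaPlus_sigmaMinus {N : ℕ} {S : Subalgebra ℂ (ChainOp N)} {k : Fin N}
    (hp : siteOp k sigmaPlus ∈ S) (hm : siteOp k sigmaMinus ∈ S) (a : SpinOp) :
    siteOp k a ∈ S := by
  have ha : a = a 0 0 • (sigmaPlus * sigmaMinus) + a 0 1 • sigmaPlus + a 1 0 • sigmaMinus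
      + a 1 1 • (sigmaMinus * sigmaPlus) := by
    ext i j
    fin_cases i <;> fin_cases j <;> simp [sigmaPlus, sigmaMinus]
  rw [ha]
  simp only [siteOp_add, siteOp_smul, ← siteOp_mul]
  exact add_mem (add_mem (add_mem (S.smul_mem (mul_mem hp hm) _) (S.smul_mem hp _))
    (S.smul_mem hm _)) (S.smul_mem (mul_mem hm hp) _)

theorem siteOp_mem_of_sigmaX_sigmaY {N : ℕ} {S : Subalgebra ℂ (ChainOp N)} {k : Fin N}
    (hx : siteOp k sigmaX ∈ S) (hy : siteOp k sigmaY ∈ S) (a : SpinOp) :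
    siteOp k a ∈ S := by
  have hp : sigmaPlus = (1 / 2 : ℂ) • sigmaX + (Complex.I / 2) • sigmaY := by
    ext i j
    fin_cases i <;> fin_cases j <;> simp [sigmaPlus, sigmaX, sigmaY] <;> ring_nf <;> norm_num
  have hm : sigmaMinus = (1 / 2 : ℂ) • sigmaX + (-Complex.I / 2) • sigmaY := by
    ext i j
    fin_cases i <;> fin_cases j <;> simp [sigmaMinus, sigmaX, sigmaY] <;> ring_nf <;> norm_num
  refine siteOp_mem_of_sigmaPlus_sigmaMinus ?_ ?_ a
  · rw [hp, siteOp_add, siteOp_smul, siteOp_smul]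
    exact add_mem (S.smul_mem hx _) (S.smul_mem hy _)
  · rw [hm, siteOp_add, siteOp_smul, siteOp_smul]
    exact add_mem (S.smul_mem hx _) (S.smul_mem hy _)

theorem tensorOp_mem {N : ℕ} {S : Subalgebra ℂ (ChainOp N)}
    (h : ∀ (k : Fin N) (a : SpinOp), siteOp k a ∈ S) (a : Fin N → SpinOp) : tensorOp a ∈ S := by
  have key : ∀ F : Finset (Fin N), tensorOp (fun j => if j ∈ F then a j else 1) ∈ S := by
    intro F
    induction F using Finset.induction_on with
    | empty => simp [tensorOp_one]
    | insert k F hk ih =>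
      have : tensorOp (fun j => if j ∈ insert k F then a j else 1)
          = tensorOp (fun j => if j ∈ F then a j else 1) * siteOp k (a k) := by
        rw [siteOp, tensorOp_mul]
        congr 1
        funext j
        by_cases hj : j = k
        · subst hj; simp [hk]
        · simp [hj]
      rw [this]
      exact mul_mem ih (h k _)
  simpa using key Finset.univ

theorem eq_top_of_siteOp_mem {N : ℕ} {S : Subalgebra ℂ (ChainOp N)}
    (h : ∀ (k : Fin N) (a : SpinOp), siteOp k a ∈ S) : S = ⊤ := by
  refine eq_top_iff.mpr fun A _ => ?_
  rw [Matrix.matrix_eq_sum_single A]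
  refine sum_mem fun s _ => sum_mem fun t _ => ?_
  have : Matrix.single s t (A s t) = A s t • tensorOp fun j => Matrix.single (s j) (t j) 1 := by
    ext s' t'
    simp only [tensorOp, Matrix.smul_apply, Matrix.of_apply, Matrix.single_apply, smul_eq_mul]
    by_cases hst : s = s' ∧ t = t'
    · simp [hst.1, hst.2]
    · rw [if_neg hst]
      have : ∃ j, ¬ (s j = s' j ∧ t j = t' j) := by
        by_contra! hc
        exact hst ⟨funext fun j => (hc j).1, funext fun j => (hc j).2⟩
      obtain ⟨j, hj⟩ := this
      rw [Finset.prod_eq_zero (Finset.mem_univ j) (if_neg hj), mul_zero]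
  rw [this]
  exact S.smul_mem (tensorOp_mem h _) _

/-- The coupling `σ_x^{(k)} σ_x^{(k+1)} + σ_y^{(k)} σ_y^{(k+1)}` of neighbouring spins. -/
def bond {N : ℕ} (k : Fin (N - 1)) : ChainOp N :=
  siteOp ⟨k.val, by omega⟩ sigmaX * siteOp ⟨k.val + 1, by omega⟩ sigmaX +
    siteOp ⟨k.val, by omega⟩ sigmaY * siteOp ⟨k.val + 1, by omega⟩ sigmaY

theorem lie_siteOp_sigmaX_bond {N : ℕ} (k : Fin (N - 1)) :
    bond k * siteOp ⟨k.val, by omega⟩ sigmaX - siteOp ⟨k.val, by omega⟩ sigmaX * bond k =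
      (-2 * Complex.I) •
        (siteOp ⟨k.val, by omega⟩ sigmaZ * siteOp ⟨k.val + 1, by omega⟩ sigmaY) := by
  have h : (⟨k.val + 1, by omega⟩ : Fin N) ≠ ⟨k.val, by omega⟩ := by simp
  rw [bond, add_mul, mul_add, mul_assoc, mul_assoc, (siteOp_commute h sigmaX sigmaX).eq,
    (siteOp_commute h sigmaY sigmaX).eq, ← mul_assoc, ← mul_assoc, ← mul_assoc,
    siteOp_mul, siteOp_mul, siteOp_mul, sigmaY_mul_sigmaX, sigmaX_mul_sigmaY, siteOp_smul,
    siteOp_smul, smul_mul_assoc, smul_mul_assoc]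
  module

theorem lie_siteOp_sigmaY_bond {N : ℕ} (k : Fin (N - 1)) :
    bond k * siteOp ⟨k.val, by omega⟩ sigmaY - siteOp ⟨k.val, by omega⟩ sigmaY * bond k =
      (2 * Complex.I) •
        (siteOp ⟨k.val, by omega⟩ sigmaZ * siteOp ⟨k.val + 1, by omega⟩ sigmaX) := by
  have h : (⟨k.val + 1, by omega⟩ : Fin N) ≠ ⟨k.val, by omega⟩ := by simp
  rw [bond, add_mul, mul_add, mul_assoc, mul_assoc, (siteOp_commute h sigmaX sigmaY).eq,
    (siteOp_commute h sigmaY sigmaY).eq, ← mul_assoc, ← mul_assoc, ← mul_assoc,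
    siteOp_mul, siteOp_mul, siteOp_mul, sigmaY_mul_sigmaX, sigmaX_mul_sigmaY, siteOp_smul,
    siteOp_smul, smul_mul_assoc, smul_mul_assoc]
  module

/-- If an algebra contains all one-site operators at the sites up to `k` and is stable under
`[H_S, ·]`, then it is stable, on operators at site `k`, under the commutator with the bond
between `k` and `k + 1`: the other terms of `H_S` either lie in the algebra or act on sites
different from `k`. -/
theorem lie_bond_mem {N : ℕ} {S : Subalgebra ℂ (ChainOp N)}
    (hH : ∀ X ∈ S, hamiltonian N * X - X * hamiltonian N ∈ S) (k : Fin (N - 1))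
    (hk : ∀ j : Fin N, j.val ≤ k.val → ∀ a, siteOp j a ∈ S) (a : SpinOp) :
    bond k * siteOp ⟨k.val, by omega⟩ a - siteOp ⟨k.val, by omega⟩ a * bond k ∈ S := by
  set X : ChainOp N := siteOp ⟨k.val, by omega⟩ a with hX
  have hXS : X ∈ S := hk _ le_rfl a
  have hZ : ∀ j : Fin N, siteOp j sigmaZ * X - X * siteOp j sigmaZ ∈ S := by
    intro j
    by_cases hj : j = ⟨k.val, by omega⟩
    · have := hk j (by rw [hj]) sigmaZ
      exact sub_mem (mul_mem this hXS) (mul_mem hXS this)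
    · rw [(siteOp_commute hj sigmaZ a).eq, sub_self]
      exact zero_mem S
  have hB : ∀ j ∈ Finset.univ.erase k, bond j * X - X * bond j ∈ S := by
    intro j hj
    rcases lt_or_gt_of_ne (Fin.val_ne_of_ne (Finset.ne_of_mem_erase hj)) with h | h
    · have : bond j ∈ S := add_mem
        (mul_mem (hk _ h.le _) (hk _ (Nat.succ_le_of_lt h) _))
        (mul_mem (hk _ h.le _) (hk _ (Nat.succ_le_of_lt h) _))
      exact sub_mem (mul_mem this hXS) (mul_mem hXS this)
    · have h1 : (⟨j.val, by omega⟩ : Fin N) ≠ ⟨k.val, by omega⟩ := by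
        simp only [ne_eq, Fin.mk.injEq]; omega
      have h2 : (⟨j.val + 1, by omega⟩ : Fin N) ≠ ⟨k.val, by omega⟩ := by
        simp only [ne_eq, Fin.mk.injEq]; omega
      have : Commute (bond j) X :=
        ((siteOp_commute h1 _ _).mul_left (siteOp_commute h2 _ _)).add_left
          ((siteOp_commute h1 _ _).mul_left (siteOp_commute h2 _ _))
      rw [this.eq, sub_self]
      exact zero_mem S
  have hsplit : bond k * X - X * bond k = (hamiltonian N * X - X * hamiltonian N)
      - ∑ j, (siteOp j sigmaZ * X - X * siteOp j sigmaZ)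
      - ∑ j ∈ Finset.univ.erase k, (bond j * X - X * bond j) := by
    have : hamiltonian N = ∑ j, siteOp j sigmaZ + (bond k + ∑ j ∈ Finset.univ.erase k, bond j) := by
      rw [Finset.add_sum_erase _ _ (Finset.mem_univ k)]
      rfl
    rw [this, Finset.sum_sub_distrib, Finset.sum_sub_distrib, ← Finset.sum_mul, ← Finset.mul_sum,
      ← Finset.sum_mul, ← Finset.mul_sum]
    noncomm_ring
  rw [hsplit]
  exact sub_mem (sub_mem (hH X hXS) (sum_mem fun j _ => hZ j)) (sum_mem hB)

theorem siteOp_succ_mem {N : ℕ} {S : Subalgebra ℂ (ChainOp N)}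
    (hH : ∀ X ∈ S, hamiltonian N * X - X * hamiltonian N ∈ S) (k : Fin (N - 1))
    (hk : ∀ j : Fin N, j.val ≤ k.val → ∀ a, siteOp j a ∈ S) (a : SpinOp) :
    siteOp ⟨k.val + 1, by omega⟩ a ∈ S := by
  -- `σ_z^{(k)}` is invertible in the algebra, hence can be cancelled.
  have cancel : ∀ (c : ℂ) (b : SpinOp), c ≠ 0 →
      c • (siteOp ⟨k.val, by omega⟩ sigmaZ * siteOp ⟨k.val + 1, by omega⟩ b) ∈ S →
        siteOp (⟨k.val + 1, by omega⟩ : Fin N) b ∈ S := by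
    intro c b hc h
    have := S.smul_mem (mul_mem (hk ⟨k.val, by omega⟩ le_rfl sigmaZ) h) c⁻¹
    rwa [mul_smul_comm, ← mul_assoc, siteOp_mul, sigmaZ_mul_self, siteOp_one, one_mul, smul_smul,
      inv_mul_cancel₀ hc, one_smul] at this
  refine siteOp_mem_of_sigmaX_sigmaY
    (cancel (2 * Complex.I) _ (by simp) ?_) (cancel (-2 * Complex.I) _ (by simp) ?_) a
  · rw [← lie_siteOp_sigmaY_bond]
    exact lie_bond_mem hH k hk _
  · rw [← lie_siteOp_sigmaX_bond]
    exact lie_bond_mem hH k hk _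

/-- The operators at the first site generate, by products and commutators with `H_S`, all
operators of the chain. -/
theorem eq_top_of_lie_hamiltonian_mem {N : ℕ} (hN : 1 ≤ N) {S : Subalgebra ℂ (ChainOp N)}
    (hp : siteOp ⟨0, hN⟩ sigmaPlus ∈ S) (hm : siteOp ⟨0, hN⟩ sigmaMinus ∈ S)
    (hH : ∀ X ∈ S, hamiltonian N * X - X * hamiltonian N ∈ S) : S = ⊤ := by
  have key : ∀ m : ℕ, ∀ j : Fin N, j.val ≤ m → ∀ a, siteOp j a ∈ S := by
    intro m
    induction m with
    | zero =>
      intro j hj a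
      obtain rfl : j = ⟨0, hN⟩ := Fin.ext (Nat.le_zero.mp hj)
      exact siteOp_mem_of_sigmaPlus_sigmaMinus hp hm a
    | succ m ih =>
      intro j hj a
      rcases Nat.lt_or_ge m j.val with h | h
      · have hjm : j.val = m + 1 := le_antisymm hj h
        have hj' : j = ⟨m + 1, by omega⟩ := Fin.ext hjm
        rw [hj']
        exact siteOp_succ_mem hH ⟨m, by omega⟩ ih a
      · exact ih j h a
  exact eq_top_of_siteOp_mem fun k a => key k.val k le_rfl a

/-! ### The master equation of the chain -/

/-- The jump operators of the chain: `σ₊` and `σ₋` at the first and at the last site. -/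
def jumpOp {N : ℕ} (hN : 1 ≤ N) : Fin 4 → ChainOp N :=
  ![siteOp ⟨0, hN⟩ sigmaPlus, siteOp ⟨0, hN⟩ sigmaMinus,
    siteOp ⟨N - 1, by omega⟩ sigmaPlus, siteOp ⟨N - 1, by omega⟩ sigmaMinus]

/-- The rates of the jump operators. -/
noncomputable def jumpRate (β β' : ℝ) : Fin 4 → ℝ :=
  ![2 * gibbs0 β, 2 * gibbs1 β, 2 * gibbs0 β', 2 * gibbs1 β']

theorem jumpRate_pos (β β' : ℝ) (j : Fin 4) : 0 < jumpRate β β' j := by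
  have h0 := gibbs0_pos β
  have h1 := gibbs1_pos β
  have h2 := gibbs0_pos β'
  have h3 := gibbs1_pos β'
  fin_cases j <;> simpa [jumpRate]

theorem exists_jumpOp_eq_conjTranspose {N : ℕ} (hN : 1 ≤ N) (j : Fin 4) :
    ∃ k, jumpOp hN k = (jumpOp hN j).conjTranspose := by
  fin_cases j
  · exact ⟨1, by simp [jumpOp, conjTranspose_siteOp, conjTranspose_sigmaPlus]⟩
  · exact ⟨0, by simp [jumpOp, conjTranspose_siteOp, conjTranspose_sigmaMinus]⟩
  · exact ⟨3, by simp [jumpOp, conjTranspose_siteOp, conjTranspose_sigmaPlus]⟩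
  · exact ⟨2, by simp [jumpOp, conjTranspose_siteOp, conjTranspose_sigmaMinus]⟩

theorem masterGenerator_eq_lindblad (N : ℕ) (hN : 1 ≤ N) (β β' : ℝ) :
    masterGenerator N hN β β' =
      Matrix.lindblad (hamiltonian N) (jumpRate β β') (jumpOp hN) := by
  refine LinearMap.ext fun ρ => ?_
  rw [Matrix.lindblad_apply, Fin.sum_univ_four]
  simp [jumpOp, jumpRate, masterGenerator, hamiltonianPart, bathPart, conjTranspose_siteOp,
    conjTranspose_sigmaPlus, conjTranspose_sigmaMinus, siteOp_mul, sigmaMinus_mul_sigmaPlus,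
    sigmaPlus_mul_sigmaMinus, add_assoc]

end SpinChain

theorem theorem3p4 (N : ℕ) (hN : 1 ≤ N) (β β' : ℝ) :
    ∃ ρ : SpinChain.ChainOp N,
      SpinChain.IsState ρ ∧
      SpinChain.IsFaithful ρ ∧
      SpinChain.IsStationary (SpinChain.semigroup N hN β β') ρ ∧
      (∀ τ : SpinChain.ChainOp N, SpinChain.IsState τ →
        SpinChain.IsStationary (SpinChain.semigroup N hN β β') τ → τ = ρ) ∧
      SpinChain.ApproachesEquilibrium (SpinChain.semigroup N hN β β') ρ := by
  have hH : (SpinChain.hamiltonian N).IsHermitian := SpinChain.conjTranspose_hamiltonian N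
  have hc := SpinChain.jumpRate_pos β β'
  have hstar := SpinChain.exists_jumpOp_eq_conjTranspose hN
  have hgen : ∀ S : Subalgebra ℂ (SpinChain.ChainOp N), (∀ j, SpinChain.jumpOp hN j ∈ S) →
      (∀ X ∈ S, SpinChain.hamiltonian N * X - X * SpinChain.hamiltonian N ∈ S) → S = ⊤ :=
    fun S hV hS => SpinChain.eq_top_of_lie_hamiltonian_mem hN (hV 0) (hV 1) hS
  obtain ⟨ρ, hρ, h0⟩ := Matrix.exists_lindblad_eq_zero (V := SpinChain.jumpOp hN) hH
    fun j => (hc j).le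
  have hpos := Matrix.posDef_of_lindblad_eq_zero hc hstar hgen hρ h0
  have hequi : SpinChain.ApproachesEquilibrium (SpinChain.semigroup N hN β β') ρ := by
    intro ξ hξ A
    have hlim := Matrix.tendsto_exp_smul_lindbladDual hH hc hstar hgen hpos hρ.2 h0 A
    have hcont : Continuous fun X : SpinChain.ChainOp N => (ξ * X).trace :=
      (continuous_const.mul continuous_id).matrix_trace
    have h := (hcont.tendsto _).comp hlim
    rw [Matrix.mul_smul, mul_one, Matrix.trace_smul, hξ.2, smul_eq_mul, mul_one] at h
    refine h.congr fun t => ?_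
    rw [SpinChain.semigroup, SpinChain.masterGenerator_eq_lindblad]
    exact (Matrix.trace_exp_smul_apply_mul Matrix.trace_lindblad_mul t ξ A).symm
  refine ⟨ρ, hρ, fun A hA => hpos.trace_mul_conjTranspose_mul_self_eq_zero_iff.mp hA,
    fun t _ => ?_, fun τ hτ hstat => ?_, hequi⟩
  · rw [SpinChain.semigroup, SpinChain.masterGenerator_eq_lindblad]
    exact Matrix.exp_smul_toContinuousLinearMap_apply_of_apply_eq_zero _ h0
  · refine Matrix.ext_iff_trace_mul_right.mpr fun A => ?_
    refine tendsto_nhds_unique ?_ (hequi τ hτ A)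
    refine tendsto_const_nhds.congr' ?_
    filter_upwards [Filter.eventually_ge_atTop 0] with t ht
    rw [hstat t ht]
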